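/- Let $g\geq 3$ be an integer. Let $\Lambda_1$ and $\Lambda_2$ be free abelian groups of rank $2$ and $2g-2$, respectively. For $i=1,2$ let $S_i\colon\Lambda_i\times\Lambda_i\to\mathbb Z$ be a positive-definite symmetric bilinear form, and let $J_i\in\mathrm{End}(\Lambda_i)$ satisfy $J_i^2=-\mathrm{Id}$ and $J_i\in \mathrm{SO}(\Lambda_{i,\mathbb R},S_i)$, i.e. the $\mathbb R$-linear extension of $J_i$ to $\Lambda_{i,\mathbb R}=\Lambda_i\otimes_{\mathbb Z}\mathbb R$ preserves $S_i$ and has determinant $1$. Let $\Lambda=\Lambda_1\oplus\Lambda_2$, let $S$ be the symmetric bilinear form on $\Lambda$ which is the orthogonal direct sum of $-S_1$ and $S_2$, and let $J_0=J_1\oplus J_2\in\mathrm{End}(\Lambda)$. Write $\Lambda_{\mathbb Q}=\Lambda\otimes_{\mathbb Z}\mathbb Q$ and $\Lambda_{\mathbb R}=\Lambda\otimes_{\mathbb Z}\mathbb R$, and denote the scalar extensions of $S$ and $J_0$ by the same letters. Then there is an element $J\in \mathrm{SO}(\Lambda_{\mathbb R},S)$ such that $J^2=-1$, the centraliser $\{u\in\mathrm{End}(\Lambda_{\mathbb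 Q}) : uJ=Ju \text{ in } \mathrm{End}(\Lambda_{\mathbb R})\}$ of $J$ in $\mathrm{End}(\Lambda_{\mathbb Q})$ is $\mathbb Q\,\mathrm{Id}_\Lambda+\mathbb Q J_0$, and the bilinear form $(x,y)\mapsto S(Jx,J_0y)$ on $\Lambda_{\mathbb R}$ is symmetric and positive-definite. -/

import Mathlib

open scoped TensorProduct

noncomputable section

/-- A symmetric, positive-definite bilinear form over an ordered ring. -/
def IsSymmPosDef {R M : Type*} [CommRing R] [LinearOrder R] [AddCommGroup M] [Module R M]
    (B : LinearMap.BilinForm R M) : Prop :=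
  B.IsSymm ∧ ∀ x : M, x ≠ 0 → 0 < B x x

/-- The special orthogonal group of a bilinear form `B`, as a subset of the endomorphism ring. -/
def specialOrthogonalSet {R M : Type*} [CommRing R] [AddCommGroup M] [Module R M]
    (B : LinearMap.BilinForm R M) : Set (Module.End R M) :=
  {f | (∀ x y : M, B (f x) (f y) = B x y) ∧ LinearMap.det f = 1}

/-- The orthogonal direct sum of two bilinear forms. -/
def orthogonalSum {R M₁ M₂ : Type*} [CommRing R] [AddCommGroup M₁] [Module R M₁]
    [AddCommGroup M₂] [Module R M₂]
    (B₁ : LinearMap.BilinForm R M₁) (B₂ : LinearMap.BilinForm R M₂) :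
    LinearMap.BilinForm R (M₁ × M₂) :=
  B₁.compl₁₂ (LinearMap.fst R M₁ M₂) (LinearMap.fst R M₁ M₂) +
    B₂.compl₁₂ (LinearMap.snd R M₁ M₂) (LinearMap.snd R M₁ M₂)

/-- The natural map from endomorphisms of `ℚ ⊗ L` to endomorphisms of `ℝ ⊗ L`: extension of
scalars along `ℚ → ℝ`, transported along the canonical isomorphism `ℝ ⊗ (ℚ ⊗ L) ≃ ℝ ⊗ L`. -/
def ratEndToReal {L : Type*} [AddCommGroup L] (u : Module.End ℚ (ℚ ⊗[ℤ] L)) :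
    Module.End ℝ (ℝ ⊗[ℤ] L) :=
  (TensorProduct.AlgebraTensorModule.cancelBaseChange ℤ ℚ ℝ ℝ L).conj (u.baseChange ℝ)

/-- The centraliser of a real endomorphism `J` of `ℝ ⊗ L` in `End (ℚ ⊗ L)`. -/
def rationalCentraliser {L : Type*} [AddCommGroup L] (J : Module.End ℝ (ℝ ⊗[ℤ] L)) :
    Set (Module.End ℚ (ℚ ⊗[ℤ] L)) :=
  {u | ratEndToReal u * J = J * ratEndToReal u}

end

/-! With `I = J₀`, the real space is a Hermitian space with exactly one negative complex direction.
Each negative vector `v` gives a candidate `J`: let it be `-I` on the complex line of `v` and `I` on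
the orthogonal complement. Then `S(Jx, J₀y)` is `S` with its sign reversed on that line, hence
positive-definite, and `J` commutes with `J₀`.

It remains to choose `v` generically. For fixed `u`, commuting with `J` is a condition quadratic in
`v` (`commutatorForm`), and it holds identically only if `u` is a complex scalar `a + bI`
(`exists_eq_add_smul`; this uses that the real dimension `2g` is at least 5). Rational endomorphisms
are countable, so by Baire some negative `v` avoids all nontrivial conditions
(`exists_neg_forall_apply_ne_zero`). Finally, a rational `u` of the form `a + bI` has rational `a`
and `b`. -/

open scoped TensorProduct

/-! ### Generic vectors and determinants over the reals -/

section RealForm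

variable {V : Type*} [AddCommGroup V] [Module ℝ V]

/-- Countably many quadratic forms, none identically zero, have a common nonzero at which a further
quadratic form that takes negative values is negative. -/
theorem exists_neg_forall_apply_ne_zero [FiniteDimensional ℝ V] {ι : Type*} [Countable ι]
    (B : LinearMap.BilinForm ℝ V) (hB : ∃ v, B v v < 0)
    (Q : ι → LinearMap.BilinForm ℝ V) (hQ : ∀ i, ∃ w, Q i w w ≠ 0) :
    ∃ v, B v v < 0 ∧ ∀ i, Q i v v ≠ 0 := by
  let e := (Module.finBasis ℝ V).equivFun
  have cont : ∀ R : LinearMap.BilinForm ℝ V, Continuous fun z => R (e.symm z) (e.symm z) := by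
    intro R
    have h : ∀ z, R (e.symm z) (e.symm z) =
        ∑ i, ∑ j, z i * (z j * R (Module.finBasis ℝ V i) (Module.finBasis ℝ V j)) := by
      intro z
      rw [Finset.sum_comm]
      simp [e, Module.Basis.equivFun_symm_apply, map_sum, LinearMap.sum_apply, Finset.mul_sum,
        mul_left_comm]
    simp_rw [h]
    fun_prop
  have hdense : Dense (⋂ i, {z | Q i (e.symm z) (e.symm z) ≠ 0}) := by
    refine dense_iInter_of_isOpen (fun i => isOpen_ne_fun (cont _) continuous_const) fun i => ?_
    obtain ⟨w, hw⟩ := hQ i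
    rw [← compl_compl {z | Q i (e.symm z) (e.symm z) ≠ 0}, ← interior_eq_empty_iff_dense_compl,
      Set.eq_empty_iff_forall_notMem]
    intro z hz
    have hline : Filter.Tendsto (fun t : ℝ => z + t • e w) (nhds 0) (nhds z) := by
      have : Continuous fun t : ℝ => z + t • e w := by fun_prop
      simpa using this.tendsto 0
    have hev := hline (mem_interior_iff_mem_nhds.1 hz)
    obtain ⟨ε, hε, hball⟩ := Metric.mem_nhds_iff.1 hev
    have key : ∀ t : ℝ, |t| < ε → Q i (e.symm z + t • w) (e.symm z + t • w) = 0 := by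
      intro t ht
      have := hball (show t ∈ Metric.ball 0 ε by simpa using ht)
      simpa [map_add] using this
    have h0 := key 0 (by simpa using hε)
    have h1 := key (ε / 2) (by rw [abs_of_pos (by positivity)]; linarith)
    have h2 := key (-(ε / 2)) (by rw [abs_neg, abs_of_pos (by positivity)]; linarith)
    simp only [map_add, map_smul, LinearMap.add_apply, LinearMap.smul_apply, smul_eq_mul,
      zero_mul, add_zero] at h0 h1 h2
    -- The second difference of `Q` along the line `z + t w`, taken at `0` and `±ε/2`, isolates the
    -- coefficient of `t ^ 2`.
    have : ε ^ 2 * Q i w w = 0 := by linear_combination 2 * h1 + 2 * h2 - 4 * h0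
    rcases mul_eq_zero.1 this with h | h
    · exact hε.ne' (by simpa using h)
    · exact hw h
  obtain ⟨v₀, hv₀⟩ := hB
  obtain ⟨z, hz, hzQ⟩ := hdense.inter_open_nonempty {z | B (e.symm z) (e.symm z) < 0}
    (isOpen_lt (cont B) continuous_const) ⟨e v₀, by simpa using hv₀⟩
  exact ⟨e.symm z, hz, by simpa using hzQ⟩

/-- A complex structure on a real vector space of finite dimension has determinant one. -/
theorem det_eq_one_of_mul_self_eq_neg_one [FiniteDimensional ℝ V] {J : Module.End ℝ V}
    (hJ : J * J = -1) : LinearMap.det J = 1 := by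
  -- Since `(1 + J)² = 2J`, the determinant of `J` is a square up to a positive factor, which
  -- excludes `-1`.
  have h1 : LinearMap.det (1 + J) * LinearMap.det (1 + J) =
      2 ^ Module.finrank ℝ V * LinearMap.det J := by
    rw [← map_mul, ← LinearMap.det_smul]
    congr 1
    rw [add_mul, mul_add, mul_add, hJ, two_smul, one_mul, one_mul, mul_one]
    abel
  have h2 : LinearMap.det J * LinearMap.det J = (-1) ^ Module.finrank ℝ V := by
    rw [← map_mul, hJ, ← neg_one_smul ℝ (1 : Module.End ℝ V), LinearMap.det_smul]
    simp
  have h3 : 0 ≤ LinearMap.det J := by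
    have := mul_self_nonneg (LinearMap.det (1 + J))
    rw [h1] at this
    exact nonneg_of_mul_nonneg_right this (by positivity)
  rcases neg_one_pow_eq_or ℝ (Module.finrank ℝ V) with h | h <;> rw [h] at h2 <;> nlinarith

/-! ### Complex structures attached to negative lines -/

/-- A symmetric form and a compatible complex structure whose negative vectors behave as those of
an indefinite Hermitian form with one negative sign. -/
structure IsLorentzian (B : LinearMap.BilinForm ℝ V) (I : Module.End ℝ V) : Prop where
  symm : ∀ x y, B x y = B y x
  sq : ∀ x, I (I x) = -x
  isometry : ∀ x y, B (I x) (I y) = B x y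
  signature : ∀ v, B v v < 0 → ∀ x, ∃ a b : ℝ,
    x - a • v - b • I v = 0 ∨ 0 < B (x - a • v - b • I v) (x - a • v - b • I v)
  exists_neg : ∃ v, B v v < 0

namespace IsLorentzian

variable {B : LinearMap.BilinForm ℝ V} {I : Module.End ℝ V}

theorem apply_right (h : IsLorentzian B I) (x y : V) : B x (I y) = -B (I x) y := by
  rw [← h.isometry x (I y), h.sq, map_neg]

theorem apply_self (h : IsLorentzian B I) (x : V) : B (I x) x = 0 := by
  have h1 := h.apply_right x x
  have h2 := h.symm x (I x)
  linarith

theorem apply_self' (h : IsLorentzian B I) (x : V) : B x (I x) = 0 := by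
  rw [h.symm, h.apply_self]

/-- By Pythagoras, the vector supplied by `signature` has norm `B x x + (a² + b²) B v v`, which is
at most `B x x`. -/
theorem pos_of_orthogonal (h : IsLorentzian B I) {v x : V} (hv : B v v < 0) (h1 : B v x = 0)
    (h2 : B (I v) x = 0) (hx : x ≠ 0) : 0 < B x x := by
  obtain ⟨a, b, hab⟩ := h.signature v hv x
  have h3 : B x v = 0 := by rw [h.symm, h1]
  have h4 : B x (I v) = 0 := by rw [h.symm, h2]
  have e : B (x - a • v - b • I v) (x - a • v - b • I v) = B x x + (a ^ 2 + b ^ 2) * B v v := by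
    simp only [map_sub, map_smul, LinearMap.sub_apply, LinearMap.smul_apply, smul_eq_mul, h1, h2,
      h3, h4, h.apply_self, h.apply_self', h.isometry]
    ring
  have hn : 0 ≤ -((a ^ 2 + b ^ 2) * B v v) := by nlinarith [sq_nonneg a, sq_nonneg b]
  rcases hab with hab | hab
  · rw [hab] at e
    simp only [map_zero] at e
    rcases hn.lt_or_eq with hn | hn
    · linarith
    · exfalso
      have h5 : a ^ 2 + b ^ 2 = 0 := by
        rcases mul_eq_zero.1 (neg_eq_zero.1 hn.symm) with h | h
        · exact h
        · exact absurd h hv.ne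
      have ha : a = 0 := by nlinarith [sq_nonneg a, sq_nonneg b]
      have hb : b = 0 := by nlinarith [sq_nonneg a, sq_nonneg b]
      apply hx
      simpa [ha, hb] using hab
  · linarith

/-- The complex structure that is `-I` on the complex line of `v` and `I` on its complement. -/
noncomputable def _root_.lineComplexStructure (B : LinearMap.BilinForm ℝ V) (I : Module.End ℝ V)
    (v : V) : Module.End ℝ V :=
  I - (2 / B v v) • ((B v).smulRight (I v) - (B (I v)).smulRight v)

theorem _root_.lineComplexStructure_apply (v x : V) : lineComplexStructure B I v x =
    I x - (2 / B v v) • (B v x • I v - B (I v) x • v) := by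
  simp [lineComplexStructure]

theorem commute_lineComplexStructure (h : IsLorentzian B I) (v : V) :
    I * lineComplexStructure B I v = lineComplexStructure B I v * I := by
  ext x
  simp only [Module.End.mul_apply, lineComplexStructure_apply, map_sub, map_smul, h.sq,
    h.apply_right, map_neg, LinearMap.neg_apply]
  module

theorem lineComplexStructure_isometry (h : IsLorentzian B I) {v : V} (hv : B v v ≠ 0) (x y : V) :
    B (lineComplexStructure B I v x) (lineComplexStructure B I v y) = B x y := by
  simp only [lineComplexStructure_apply, map_sub, map_smul, LinearMap.sub_apply,
    LinearMap.smul_apply, smul_eq_mul, h.isometry, h.apply_self, h.apply_self']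
  rw [h.symm (I x) v, h.apply_right v x, h.symm x v, h.apply_right v y]
  field_simp
  ring

theorem lineComplexStructure_mul_self (h : IsLorentzian B I) {v : V} (hv : B v v ≠ 0) :
    lineComplexStructure B I v * lineComplexStructure B I v = -1 := by
  ext x
  simp only [Module.End.mul_apply, lineComplexStructure_apply, map_sub, map_smul, h.sq,
    h.apply_right, h.apply_self, LinearMap.neg_apply,
    Module.End.one_apply, map_neg]
  match_scalars <;> field_simp <;> ring

theorem apply_lineComplexStructure (h : IsLorentzian B I) (v x y : V) :
    B (lineComplexStructure B I v x) (I y) =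
      B x y - (2 / B v v) * (B v x * B v y + B (I v) x * B (I v) y) := by
  simp only [lineComplexStructure_apply, map_sub, map_smul, LinearMap.sub_apply,
    LinearMap.smul_apply, smul_eq_mul, h.isometry, h.apply_right]
  ring

/-- Write `x` as `y` plus its projection to the complex line of `v`. The twisted form keeps `B y y`,
which is positive unless `y = 0`, and turns the negative contribution of the line into `(p² + q²) /
(-s)`. -/
theorem isSymmPosDef (h : IsLorentzian B I) {v : V} (hv : B v v < 0) :
    IsSymmPosDef (B.compl₁₂ (lineComplexStructure B I v) I) := by
  refine ⟨⟨fun x y => ?_⟩, fun x hx => ?_⟩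
  · simp only [LinearMap.compl₁₂_apply, h.apply_lineComplexStructure]
    rw [h.symm x y]
    ring
  · simp only [LinearMap.compl₁₂_apply, h.apply_lineComplexStructure]
    set p := B v x with hp
    set q := B (I v) x with hq
    set s := B v v with hs
    have hs0 : s ≠ 0 := hv.ne
    have hp' : B x v = p := h.symm x v
    have hq' : B x (I v) = q := h.symm x (I v)
    let y := x - (p / s) • v - (q / s) • I v
    have h1 : B v y = 0 := by
      simp only [y, map_sub, map_smul, smul_eq_mul, h.apply_self', ← hs, ← hp]
      field_simp
      ring
    have h2 : B (I v) y = 0 := by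
      simp only [y, map_sub, map_smul, smul_eq_mul, h.apply_self, h.isometry, ← hs, ← hq]
      field_simp
      ring
    have hy : B y y = B x x - (p ^ 2 + q ^ 2) / s := by
      have : B y y = B x y := by
        change B (x - (p / s) • v - (q / s) • I v) y = B x y
        rw [B.map_sub, B.map_sub, LinearMap.sub_apply, LinearMap.sub_apply, B.map_smul, B.map_smul,
          LinearMap.smul_apply, LinearMap.smul_apply]
        change B x y - (p / s) • B v y - (q / s) • B (I v) y = _
        rw [h1, h2]
        simp
      rw [this]
      simp only [y, map_sub, map_smul, smul_eq_mul, hp', hq']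
      field_simp
      ring
    have e : B x x - 2 / s * (p * p + q * q) = B y y + (p ^ 2 + q ^ 2) / (-s) := by
      rw [hy]
      field_simp
      ring
    rw [e]
    have hpq : 0 ≤ (p ^ 2 + q ^ 2) / (-s) := div_nonneg (by positivity) (by linarith)
    by_cases hy0 : y = 0
    · rw [hy0]
      simp only [map_zero, zero_add]
      refine lt_of_le_of_ne hpq fun h0 => hx ?_
      have h5 : p ^ 2 + q ^ 2 = 0 := by
        rcases div_eq_zero_iff.1 h0.symm with h | h
        · exact h
        · exact absurd (neg_eq_zero.1 h) hs0
      have hp0 : p = 0 := by nlinarith [sq_nonneg p, sq_nonneg q]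
      have hq0 : q = 0 := by nlinarith [sq_nonneg p, sq_nonneg q]
      simpa [y, hp0, hq0] using hy0
    · linarith [h.pos_of_orthogonal hv h1 h2 hy0]

end IsLorentzian

/-! ### The commutation relation as a quadratic condition -/

/-- The polarised commutation relation of `u` with the complex structures of complex lines. -/
noncomputable def commutatorForm (B : LinearMap.BilinForm ℝ V) (I u : Module.End ℝ V) (x : V) :
    V →ₗ[ℝ] V →ₗ[ℝ] V :=
  B.compr₂ (LinearMap.toSpanSingleton ℝ V (u (I x) - I (u x))) -
  (2 : ℝ) • (LinearMap.lsmul ℝ V).compl₁₂ (B x) (u * I) +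
  (2 : ℝ) • (LinearMap.lsmul ℝ V).compl₁₂ ((B x).comp I) u +
  (2 : ℝ) • (LinearMap.lsmul ℝ V).compl₁₂ (B (u x)) I -
  (2 : ℝ) • (LinearMap.lsmul ℝ V).compl₁₂ ((B (u x)).comp I) LinearMap.id

theorem commutatorForm_apply (B : LinearMap.BilinForm ℝ V) (I u : Module.End ℝ V) (x v w : V) :
    commutatorForm B I u x v w = B v w • (u (I x) - I (u x)) - (2 : ℝ) • B x v • u (I w) +
      (2 : ℝ) • B x (I v) • u w + (2 : ℝ) • B (u x) v • I w - (2 : ℝ) • B (u x) (I v) • w := by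
  simp [commutatorForm]

namespace IsLorentzian

variable {B : LinearMap.BilinForm ℝ V} {I : Module.End ℝ V}

/-- Multiplying the commutation relation at `x` by `B v v` clears its only denominator and leaves an
expression quadratic in `v`. -/
theorem commutatorForm_eq_zero (h : IsLorentzian B I) {v : V} (hv : B v v ≠ 0)
    {u : Module.End ℝ V} (hu : u * lineComplexStructure B I v = lineComplexStructure B I v * u)
    (x : V) : commutatorForm B I u x v v = 0 := by
  have hx := LinearMap.congr_fun hu x
  simp only [Module.End.mul_apply, lineComplexStructure_apply, map_sub, map_smul] at hx
  have hx' := congrArg (fun z => B v v • z) (sub_eq_zero.2 hx)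
  simp only [smul_zero] at hx'
  rw [commutatorForm_apply, h.symm x v, h.symm x (I v), h.symm (u x) v, h.symm (u x) (I v), ← hx']
  match_scalars <;> field_simp

theorem exists_ne_zero_orthogonal [FiniteDimensional ℝ V] (hd : 5 ≤ Module.finrank ℝ V)
    (B : LinearMap.BilinForm ℝ V) (f : Fin 4 → V) : ∃ y, y ≠ 0 ∧ ∀ i, B (f i) y = 0 := by
  have := LinearMap.ker_ne_bot_of_finrank_lt (f := LinearMap.pi fun i => B (f i))
    (by rw [Module.finrank_fin_fun]; omega)
  obtain ⟨y, hy, hy0⟩ := Submodule.exists_mem_ne_zero_of_ne_bot this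
  exact ⟨y, hy0, fun i => congrFun (LinearMap.mem_ker.1 hy) i⟩

/-- If `x` is negative and `v`, `w` span complex lines orthogonal to it and to each other, the
relations at `v` and `w` put `u (I x) - I (u x)` in both lines, so it vanishes. Hence `u` commutes
with `I`, and the simplified relation `hrel` shows that `u` acts by one complex scalar. -/
theorem exists_eq_add_smul [FiniteDimensional ℝ V] (hd : 5 ≤ Module.finrank ℝ V)
    (h : IsLorentzian B I) {u : Module.End ℝ V} (hu : ∀ x v, commutatorForm B I u x v v = 0) :
    ∃ a b : ℝ, u = a • 1 + b • I := by
  have hneg : ∀ x, B x x < 0 → u (I x) - I (u x) = 0 := by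
    intro x hx
    obtain ⟨v, hv0, hv⟩ := exists_ne_zero_orthogonal hd B ![x, I x, x, I x]
    obtain ⟨w, hw0, hw⟩ := exists_ne_zero_orthogonal hd B ![x, I x, v, I v]
    have hxv : B x v = 0 := hv 0
    have hxIv : B x (I v) = 0 := by rw [h.apply_right, show B (I x) v = 0 from hv 1, neg_zero]
    have hxw : B x w = 0 := hw 0
    have hxIw : B x (I w) = 0 := by rw [h.apply_right, show B (I x) w = 0 from hw 1, neg_zero]
    have hvw : B v w = 0 := hw 2
    have hIvw : B (I v) w = 0 := hw 3
    have hvIw : B v (I w) = 0 := by rw [h.apply_right, hIvw, neg_zero]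
    have pv := h.pos_of_orthogonal hx hxv (hv 1) hv0
    have pw := h.pos_of_orthogonal hx hxw (hw 1) hw0
    have ev := hu x v
    have ew := hu x w
    rw [commutatorForm_apply] at ev ew
    simp only [hxv, hxIv, hxw, hxIw, zero_smul, smul_zero, sub_zero, add_zero] at ev ew
    set c := u (I x) - I (u x)
    have c1 : B v c = 0 := by
      have := congrArg (B v) ew
      simp only [map_sub, map_add, map_smul, hvw, hvIw, mul_zero, add_zero, sub_zero, map_zero,
        smul_eq_mul] at this
      exact (mul_eq_zero.1 this).resolve_left pw.ne'
    have c2 : B (I v) c = 0 := by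
      have := congrArg (B (I v)) ew
      simp only [map_sub, map_add, map_smul, hIvw, h.isometry, hvw, mul_zero, add_zero, sub_zero,
        map_zero, smul_eq_mul] at this
      exact (mul_eq_zero.1 this).resolve_left pw.ne'
    have d1 := congrArg (B v) ev
    have d2 := congrArg (B (I v)) ev
    simp only [map_sub, map_add, map_smul, c1, c2, h.apply_self, h.apply_self', h.isometry,
      add_zero, sub_zero, zero_add, zero_sub, map_zero, smul_eq_mul, mul_zero] at d1 d2
    have z1 : B (u x) (I v) = 0 := by
      have : B (u x) (I v) * B v v = 0 := by linarith
      exact (mul_eq_zero.1 this).resolve_right pv.ne'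
    have z2 : B (u x) v = 0 := by
      have : B (u x) v * B v v = 0 := by linarith
      exact (mul_eq_zero.1 this).resolve_right pv.ne'
    simp only [z1, z2, zero_smul, smul_zero, add_zero, sub_zero] at ev
    exact (smul_eq_zero.1 ev).resolve_left pv.ne'
  obtain ⟨e, he⟩ := h.exists_neg
  have hcomm : ∀ x, u (I x) = I (u x) := by
    intro x
    obtain ⟨t, ht⟩ : ∃ t : ℝ, B (x + t • e) (x + t • e) < 0 := by
      have hexp : ∀ t : ℝ, B (x + t • e) (x + t • e) =
          B x x + 2 * t * B e x + t ^ 2 * B e e := by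
        intro t
        simp only [map_add, map_smul, LinearMap.add_apply, LinearMap.smul_apply, smul_eq_mul,
          h.symm x e]
        ring
      -- Commutation is known on negative vectors; a large multiple of `e` makes `x + t e` negative,
      -- and linearity then gives it for `x`.
      let m := (|B x x| + 2 * |B e x| + 1) / (-B e e)
      have hm0 : 0 ≤ m := div_nonneg (by positivity) (by linarith)
      refine ⟨1 + m, ?_⟩
      rw [hexp]
      have hm : m * B e e = -(|B x x| + 2 * |B e x| + 1) := by
        simp only [m]
        have := he.ne
        field_simp
      have a1 := le_abs_self (B x x)
      have a2 := le_abs_self (B e x)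
      have a3 : 2 * (1 + m) * B e x ≤ 2 * (1 + m) * |B e x| :=
        mul_le_mul_of_nonneg_left a2 (by linarith)
      have a4 : (1 + m) ^ 2 * B e e =
          (1 + m) * B e e - (1 + m) * (|B x x| + 2 * |B e x| + 1) := by
        linear_combination (1 + m) * hm
      have a5 : (1 + m) * B e e ≤ 0 := mul_nonpos_of_nonneg_of_nonpos (by linarith) he.le
      have a6 : 0 ≤ m * |B x x| := mul_nonneg hm0 (abs_nonneg _)
      nlinarith
    have h1 := hneg _ ht
    have h2 := hneg e he
    simp only [map_add, map_smul] at h1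
    have : u (I x) - I (u x) + t • (u (I e) - I (u e)) = 0 := by
      rw [← h1]
      module
    rw [h2, smul_zero, add_zero] at this
    exact sub_eq_zero.1 this
  have hrel : ∀ x v, B x v • I (u v) - B x (I v) • u v = B (u x) v • I v - B (u x) (I v) • v := by
    intro x v
    have := hu x v
    rw [commutatorForm_apply, hcomm x, hcomm v, sub_self, smul_zero] at this
    have h2 := congrArg (fun z => (-1 / 2 : ℝ) • z) this
    simp only [smul_zero] at h2
    rw [← sub_eq_zero, ← h2]
    module
  obtain ⟨a, b, hab⟩ : ∃ a b : ℝ, u e = a • e + b • I e := by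
    have h1 := hrel e e
    rw [h.apply_self', zero_smul, sub_zero] at h1
    have h2 := congrArg (fun z => (-1 / B e e) • I z) h1
    simp only [map_sub, map_smul, h.sq] at h2
    refine ⟨B (u e) e / B e e, B (u e) (I e) / B e e, ?_⟩
    rw [smul_smul, div_mul_cancel₀ _ he.ne, neg_smul_neg, one_smul] at h2
    generalize B (u e) e = p at h2 ⊢
    generalize B (u e) (I e) = q at h2 ⊢
    rw [h2]
    module
  have hgen : ∀ v, ¬ (B e v = 0 ∧ B e (I v) = 0) → u v = a • v + b • I v := by
    intro v hv
    have h1 := hrel e v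
    rw [hab] at h1
    simp only [map_add, map_smul, LinearMap.add_apply, LinearMap.smul_apply, smul_eq_mul,
      h.isometry] at h1
    have hIe : B (I e) v = -B e (I v) := by rw [h.apply_right, neg_neg]
    rw [hIe] at h1
    set p := B e v
    set q := B e (I v)
    have hpq : p ^ 2 + q ^ 2 ≠ 0 := fun h0 =>
      hv ⟨by nlinarith [sq_nonneg p, sq_nonneg q], by nlinarith [sq_nonneg p, sq_nonneg q]⟩
    -- The operator `p I - q` kills the error term, and it is invertible because `p² + q²` is
    -- nonzero.
    have h2 : p • I (u v - (a • v + b • I v)) - q • (u v - (a • v + b • I v)) = 0 := by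
      rw [map_sub, map_add, map_smul, map_smul, h.sq]
      rw [← sub_eq_zero] at h1
      rw [← h1]
      module
    set y := u v - (a • v + b • I v) with hy
    have h3 : (p ^ 2 + q ^ 2) • y = 0 := by
      have h4 := congrArg I h2
      simp only [map_sub, map_smul, h.sq, map_zero] at h4
      have : (p ^ 2 + q ^ 2) • y = -(p • (p • -y - q • I y)) - q • (p • I y - q • y) := by module
      rw [this, h4, h2]
      simp
    exact sub_eq_zero.1 ((smul_eq_zero.1 h3).resolve_left hpq)
  refine ⟨a, b, LinearMap.ext fun v => ?_⟩
  simp only [LinearMap.add_apply, LinearMap.smul_apply, Module.End.one_apply]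
  by_cases hv : B e v = 0 ∧ B e (I v) = 0
  -- A vector orthogonal to the line of `e` is no longer so after adding `e`.
  · have h1 := hgen (e + v) fun h0 => by
      have := h0.1
      rw [map_add, hv.1, add_zero] at this
      exact he.ne this
    rw [map_add, hab] at h1
    rw [map_add] at h1
    rw [← sub_eq_zero] at h1 ⊢
    rw [← h1]
    module
  · exact hgen v hv

/-- For countably many endomorphisms there is a negative vector whose complex structure commutes
only with those among them that are complex scalars. -/
theorem exists_neg_forall_commute [FiniteDimensional ℝ V] (hd : 5 ≤ Module.finrank ℝ V)
    (h : IsLorentzian B I) {ι : Type*} [Countable ι] (u : ι → Module.End ℝ V) :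
    ∃ v, B v v < 0 ∧ ∀ i, u i * lineComplexStructure B I v = lineComplexStructure B I v * u i →
      ∃ a b : ℝ, u i = a • 1 + b • I := by
  let κ := {i // ∃ x w, commutatorForm B I (u i) x w w ≠ 0}
  have hκ : ∀ k : κ, ∃ (x : V) (Q : LinearMap.BilinForm ℝ V), (∃ w, Q w w ≠ 0) ∧
      ∀ w, Q w w ≠ 0 → commutatorForm B I (u k) x w w ≠ 0 := by
    rintro ⟨i, x, w, hw⟩
    -- A functional nonzero at one value turns the vector-valued condition into a scalar quadratic
    -- form.
    obtain ⟨f, hf⟩ := Module.Projective.exists_dual_ne_zero ℝ hw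
    exact ⟨x, (commutatorForm B I (u i) x).compr₂ f, ⟨w, by simpa using hf⟩,
      fun w hw h0 => hw (by simp [h0])⟩
  choose x Q hQ hQx using hκ
  obtain ⟨v, hv, hvQ⟩ := exists_neg_forall_apply_ne_zero B h.exists_neg Q hQ
  refine ⟨v, hv, fun i hi => h.exists_eq_add_smul hd fun y w => ?_⟩
  by_contra hne
  exact hQx ⟨i, y, w, hne⟩ v (hvQ _) (h.commutatorForm_eq_zero hv.ne hi _)

end IsLorentzian

end RealForm

/-- Applying `J` to `s w + t J w = 0` yields `(s² + t²) w = 0`, so `w` and `J w` form a basis. -/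
theorem exists_eq_add_smul_of_finrank_eq_two {W : Type*} [AddCommGroup W] [Module ℝ W]
    (hd : Module.finrank ℝ W = 2) {J : Module.End ℝ W} (hJ : ∀ x, J (J x) = -x) {w : W}
    (hw : w ≠ 0) (x : W) : ∃ a b : ℝ, x = a • w + b • J w := by
  have : FiniteDimensional ℝ W := Module.finite_of_finrank_pos (by omega)
  have hli : LinearIndependent ℝ ![w, J w] := by
    rw [LinearIndependent.pair_iff]
    intro s t h
    have h' := congrArg J h
    simp only [map_add, map_smul, hJ, map_zero] at h'
    have h3 : (s ^ 2 + t ^ 2) • w = 0 := by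
      have : (s ^ 2 + t ^ 2) • w = s • (s • w + t • J w) - t • (s • J w + t • -w) := by module
      rw [this, h, h']
      simp
    have h4 := (smul_eq_zero.1 h3).resolve_right hw
    constructor <;> nlinarith [sq_nonneg s, sq_nonneg t]
  have hspan := hli.span_eq_top_of_card_eq_finrank' (by simp [hd])
  have hx : x ∈ Submodule.span ℝ (Set.range ![w, J w]) := hspan ▸ Submodule.mem_top
  rw [Matrix.range_cons_cons_empty, Submodule.mem_span_pair] at hx
  obtain ⟨a, b, h⟩ := hx
  exact ⟨a, b, h.symm⟩

/-! ### Rational and real points of a lattice -/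

section Lattice

variable {L : Type*} [AddCommGroup L]

theorem exists_smul_eq_one_tmul (v : ℚ ⊗[ℤ] L) :
    ∃ d : ℤ, d ≠ 0 ∧ ∃ b : L, (d : ℚ) • v = 1 ⊗ₜ[ℤ] b := by
  induction v with
  | zero => exact ⟨1, one_ne_zero, 0, by simp⟩
  | tmul q x =>
    refine ⟨q.den, by simp, q.num • x, ?_⟩
    rw [← TensorProduct.smul_tmul, TensorProduct.smul_tmul']
    congr 1
    simp [Rat.den_mul_eq_num]
  | add x y hx hy =>
    obtain ⟨d, hd, b, hb⟩ := hx
    obtain ⟨e, he, c, hc⟩ := hy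
    refine ⟨d * e, mul_ne_zero hd he, e • b + d • c, ?_⟩
    have h1 : ((d * e : ℤ) : ℚ) • (x + y) = e • ((d : ℚ) • x) + d • ((e : ℚ) • y) := by
      simp only [← Int.cast_smul_eq_zsmul ℚ]
      push_cast
      module
    rw [h1, hb, hc, TensorProduct.tmul_add, TensorProduct.tmul_smul, TensorProduct.tmul_smul]

/-- A positive-definite form on a lattice stays positive-definite over the reals. -/
theorem baseChange_real_pos [Module.Free ℤ L] [Module.Finite ℤ L] {S : LinearMap.BilinForm ℤ L}
    (hS : IsSymmPosDef S) {x : ℝ ⊗[ℤ] L} (hx : x ≠ 0) : 0 < S.baseChange ℝ x x := by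
  -- A limit argument would give only semidefiniteness. An orthogonal basis over `ℚ`, scaled into
  -- the lattice, instead makes the real form a sum of squares with positive coefficients.
  let : Invertible (2 : ℚ) := invertibleOfNonzero two_ne_zero
  obtain ⟨v, hv⟩ := LinearMap.BilinForm.exists_orthogonal_basis
    (LinearMap.BilinForm.IsSymm.baseChange ℚ ⟨fun x y => hS.1.eq x y⟩)
  choose d hd b hb using fun i => exists_smul_eq_one_tmul (v i)
  have hb0 : ∀ i, b i ≠ 0 := by
    intro i h0
    have h := hb i
    rw [h0, TensorProduct.tmul_zero] at h
    exact v.ne_zero i ((smul_eq_zero.1 h).resolve_left (by exact_mod_cast hd i))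
  have horth : ∀ i j, i ≠ j → S (b i) (b j) = 0 := by
    intro i j hij
    have h : S.baseChange ℚ (1 ⊗ₜ b i) (1 ⊗ₜ b j) = 0 := by
      rw [← hb, ← hb, map_smul, map_smul, LinearMap.smul_apply, LinearMap.isOrthoᵢ_def.1 hv i j hij]
      simp
    simpa using h
  let r : Fin (Module.finrank ℚ (ℚ ⊗[ℤ] L)) → ℝ ⊗[ℤ] L := fun i => 1 ⊗ₜ b i
  have hr : ∀ i j, S.baseChange ℝ (r i) (r j) = (S (b i) (b j) : ℝ) := by
    intro i j
    simp [r]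
  have hli : LinearIndependent ℝ r := by
    refine LinearMap.linearIndependent_of_isOrthoᵢ (B := S.baseChange ℝ)
      (LinearMap.isOrthoᵢ_def.2 fun i j hij => ?_) fun i => ?_
    · rw [hr, horth i j hij, Int.cast_zero]
    · rw [hr]
      exact_mod_cast (hS.2 _ (hb0 i)).ne'
  have hspan := hli.span_eq_top_of_card_eq_finrank'
    (by rw [Fintype.card_fin, Module.finrank_baseChange, Module.finrank_baseChange])
  obtain ⟨c, rfl⟩ := (Submodule.mem_span_range_iff_exists_fun ℝ).1
    (show x ∈ Submodule.span ℝ (Set.range r) from hspan ▸ Submodule.mem_top)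
  have hsum : S.baseChange ℝ (∑ i, c i • r i) (∑ i, c i • r i) =
      ∑ i, c i ^ 2 * (S (b i) (b i) : ℝ) := by
    simp only [map_sum, map_smul, LinearMap.sum_apply, LinearMap.smul_apply, smul_eq_mul, hr]
    refine Finset.sum_congr rfl fun i _ => ?_
    rw [Finset.sum_eq_single i]
    · ring
    · intro j _ hji
      rw [horth j i hji]
      simp
    · simp
  have hbpos : ∀ i, (0 : ℝ) < S (b i) (b i) := fun i => by exact_mod_cast hS.2 _ (hb0 i)
  obtain ⟨i, hi⟩ : ∃ i, c i ≠ 0 := by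
    by_contra! h
    exact hx (by simp [h])
  rw [hsum]
  exact Finset.sum_pos' (fun i _ => mul_nonneg (sq_nonneg _) (hbpos i).le)
    ⟨i, Finset.mem_univ _, mul_pos (by positivity) (hbpos i)⟩

theorem countable_end_rat (M : Type*) [AddCommGroup M] [Module ℚ M] [Module.Finite ℚ M] :
    Countable (Module.End ℚ M) := by
  have e := LinearMap.toMatrix (Module.finBasis ℚ M) (Module.finBasis ℚ M)
  have : Countable (Matrix (Fin (Module.finrank ℚ M)) (Fin (Module.finrank ℚ M)) ℚ) :=
    inferInstanceAs (Countable (_ → _ → ℚ))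
  exact e.injective.countable

/-- The inclusion of the rational points of a lattice into its real points. -/
noncomputable def ratToReal (L : Type*) [AddCommGroup L] : ℚ ⊗[ℤ] L →+ ℝ ⊗[ℤ] L :=
  (LinearMap.rTensor L (algebraMap ℚ ℝ).toAddMonoidHom.toIntLinearMap).toAddMonoidHom

theorem ratToReal_tmul (q : ℚ) (x : L) : ratToReal L (q ⊗ₜ x) = (q : ℝ) ⊗ₜ x :=
  rfl

theorem ratToReal_injective [Module.Free ℤ L] : Function.Injective (ratToReal L) :=
  Module.Flat.rTensor_preserves_injective_linearMap _ (algebraMap ℚ ℝ).injective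

theorem ratEndToReal_one_tmul (u : Module.End ℚ (ℚ ⊗[ℤ] L)) (x : L) :
    ratEndToReal u (1 ⊗ₜ x) = ratToReal L (u (1 ⊗ₜ x)) := by
  have h : ∀ y : ℚ ⊗[ℤ] L, TensorProduct.AlgebraTensorModule.cancelBaseChange ℤ ℚ ℝ ℝ L
      ((1 : ℝ) ⊗ₜ[ℚ] y) = ratToReal L y := by
    intro y
    induction y with
    | zero => simp
    | tmul q z =>
      rw [ratToReal_tmul, TensorProduct.AlgebraTensorModule.cancelBaseChange_tmul, Rat.smul_def,
        mul_one]
    | add y z hy hz => rw [TensorProduct.tmul_add, map_add, map_add, hy, hz]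
  rw [ratEndToReal, LinearEquiv.conj_apply_apply,
    TensorProduct.AlgebraTensorModule.cancelBaseChange_symm_tmul, LinearMap.baseChange_tmul, h]

theorem ratEndToReal_injective [Module.Free ℤ L] :
    Function.Injective (ratEndToReal : Module.End ℚ (ℚ ⊗[ℤ] L) → Module.End ℝ (ℝ ⊗[ℤ] L)) := by
  intro u v h
  ext x
  apply ratToReal_injective
  simpa [ratEndToReal_one_tmul] using LinearMap.congr_fun h (1 ⊗ₜ x)

theorem ratEndToReal_add_smul (K : Module.End ℤ L) (a b : ℚ) :
    ratEndToReal (a • (1 : Module.End ℚ (ℚ ⊗[ℤ] L)) + b • K.baseChange ℚ) =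
      (a : ℝ) • 1 + (b : ℝ) • K.baseChange ℝ := by
  ext x
  simp [ratEndToReal_one_tmul, TensorProduct.smul_tmul', ratToReal_tmul]

theorem exists_rat_apply_ratToReal (S : LinearMap.BilinForm ℤ L) (y : ℚ ⊗[ℤ] L) (z : L) :
    ∃ q : ℚ, S.baseChange ℝ (ratToReal L y) (1 ⊗ₜ z) = q := by
  induction y with
  | zero => exact ⟨0, by simp⟩
  | tmul q x => exact ⟨S x z * q, by simp [ratToReal_tmul]⟩
  | add x y hx hy =>
    obtain ⟨p, hp⟩ := hx
    obtain ⟨q, hq⟩ := hy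
    exact ⟨p + q, by rw [map_add, map_add, LinearMap.add_apply, hp, hq, Rat.cast_add]⟩

end Lattice

/-! ### The signature of the orthogonal sum -/

section OrthogonalSum

variable {L₁ L₂ : Type*} [AddCommGroup L₁] [AddCommGroup L₂]

theorem orthogonalSum_baseChange_apply (S₁ : LinearMap.BilinForm ℤ L₁)
    (S₂ : LinearMap.BilinForm ℤ L₂) (x y : ℝ ⊗[ℤ] (L₁ × L₂)) :
    (orthogonalSum (-S₁) S₂).baseChange ℝ x y =
      -S₁.baseChange ℝ ((LinearMap.fst ℤ L₁ L₂).baseChange ℝ x)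
        ((LinearMap.fst ℤ L₁ L₂).baseChange ℝ y) +
      S₂.baseChange ℝ ((LinearMap.snd ℤ L₁ L₂).baseChange ℝ x)
        ((LinearMap.snd ℤ L₁ L₂).baseChange ℝ y) := by
  induction x with
  | zero => simp
  | add x x' hx hx' =>
    simp only [map_add, LinearMap.add_apply, hx, hx']
    ring
  | tmul a x =>
    induction y with
    | zero => simp
    | add y y' hy hy' =>
      simp only [map_add, hy, hy']
      ring
    | tmul b y =>
      simp [orthogonalSum]
      ring

theorem eq_zero_of_baseChange_fst_snd {x : ℝ ⊗[ℤ] (L₁ × L₂)}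
    (h₁ : (LinearMap.fst ℤ L₁ L₂).baseChange ℝ x = 0)
    (h₂ : (LinearMap.snd ℤ L₁ L₂).baseChange ℝ x = 0) : x = 0 := by
  have h : (LinearMap.inl ℤ L₁ L₂).comp (LinearMap.fst ℤ L₁ L₂) +
      (LinearMap.inr ℤ L₁ L₂).comp (LinearMap.snd ℤ L₁ L₂) = LinearMap.id := by
    ext <;> simp
  have hx := LinearMap.congr_fun (congrArg (LinearMap.baseChange ℝ) h) x
  rw [LinearMap.baseChange_add, LinearMap.baseChange_comp, LinearMap.baseChange_comp,
    LinearMap.baseChange_id] at hx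
  simpa [h₁, h₂] using hx.symm

theorem baseChange_apply_apply {L : Type*} [AddCommGroup L] {J : Module.End ℤ L}
    (hJ : J * J = -1) (x : ℝ ⊗[ℤ] L) : J.baseChange ℝ (J.baseChange ℝ x) = -x := by
  have h := LinearMap.congr_fun (congrArg (LinearMap.baseChange ℝ) hJ) x
  rw [LinearMap.baseChange_mul] at h
  rw [← Module.End.mul_apply, h, LinearMap.baseChange_neg]
  simp

theorem baseChange_fst_prodMap (J₁ : Module.End ℤ L₁) (J₂ : Module.End ℤ L₂)
    (x : ℝ ⊗[ℤ] (L₁ × L₂)) :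
    (LinearMap.fst ℤ L₁ L₂).baseChange ℝ ((J₁.prodMap J₂).baseChange ℝ x) =
      J₁.baseChange ℝ ((LinearMap.fst ℤ L₁ L₂).baseChange ℝ x) := by
  rw [← LinearMap.comp_apply, ← LinearMap.comp_apply, ← LinearMap.baseChange_comp,
    ← LinearMap.baseChange_comp]
  rfl

theorem baseChange_snd_prodMap (J₁ : Module.End ℤ L₁) (J₂ : Module.End ℤ L₂)
    (x : ℝ ⊗[ℤ] (L₁ × L₂)) :
    (LinearMap.snd ℤ L₁ L₂).baseChange ℝ ((J₁.prodMap J₂).baseChange ℝ x) =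
      J₂.baseChange ℝ ((LinearMap.snd ℤ L₁ L₂).baseChange ℝ x) := by
  rw [← LinearMap.comp_apply, ← LinearMap.comp_apply, ← LinearMap.baseChange_comp,
    ← LinearMap.baseChange_comp]
  rfl

theorem isLorentzian_orthogonalSum [Module.Free ℤ L₁] [Module.Free ℤ L₂]
    [Module.Finite ℤ L₂] (hd : Module.finrank ℤ L₁ = 2) {S₁ : LinearMap.BilinForm ℤ L₁}
    {S₂ : LinearMap.BilinForm ℤ L₂} (hS₁ : IsSymmPosDef S₁) (hS₂ : IsSymmPosDef S₂)
    {J₁ : Module.End ℤ L₁} {J₂ : Module.End ℤ L₂}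
    (hJ₁ : ∀ x y, S₁.baseChange ℝ (J₁.baseChange ℝ x) (J₁.baseChange ℝ y) = S₁.baseChange ℝ x y)
    (hJ₂ : ∀ x y, S₂.baseChange ℝ (J₂.baseChange ℝ x) (J₂.baseChange ℝ y) = S₂.baseChange ℝ x y)
    (hJ₁sq : J₁ * J₁ = -1) (hJ₂sq : J₂ * J₂ = -1) :
    IsLorentzian ((orthogonalSum (-S₁) S₂).baseChange ℝ) ((J₁.prodMap J₂).baseChange ℝ) where
  symm x y := by
    have h₁ := (LinearMap.BilinForm.IsSymm.baseChange ℝ (B₂ := S₁) ⟨fun x y => hS₁.1.eq x y⟩).eq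
    have h₂ := (LinearMap.BilinForm.IsSymm.baseChange ℝ (B₂ := S₂) ⟨fun x y => hS₂.1.eq x y⟩).eq
    simp only [RingHom.id_apply] at h₁ h₂
    rw [orthogonalSum_baseChange_apply, orthogonalSum_baseChange_apply, h₁, h₂]
  sq x := by
    refine baseChange_apply_apply ?_ x
    rw [LinearMap.prodMap_mul, hJ₁sq, hJ₂sq]
    ext <;> simp
  isometry x y := by
    simp only [orthogonalSum_baseChange_apply, baseChange_fst_prodMap, baseChange_snd_prodMap,
      hJ₁, hJ₂]
  signature v hv x := by
    have hv₁ : (LinearMap.fst ℤ L₁ L₂).baseChange ℝ v ≠ 0 := by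
      intro h0
      rw [orthogonalSum_baseChange_apply, h0] at hv
      by_cases h2 : (LinearMap.snd ℤ L₁ L₂).baseChange ℝ v = 0
      · simp [h2] at hv
      · have := baseChange_real_pos hS₂ h2
        simp only [map_zero, neg_zero, zero_add] at hv
        linarith
    -- The first component of `v` spans the first summand as a complex line, so the first component
    -- of `x` can be subtracted away, leaving a vector of the positive summand.
    obtain ⟨a, b, hab⟩ := exists_eq_add_smul_of_finrank_eq_two
      (by rw [Module.finrank_baseChange, hd]) (baseChange_apply_apply hJ₁sq) hv₁
      ((LinearMap.fst ℤ L₁ L₂).baseChange ℝ x)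
    refine ⟨a, b, ?_⟩
    set y := x - a • v - b • (J₁.prodMap J₂).baseChange ℝ v with hy
    have hy₁ : (LinearMap.fst ℤ L₁ L₂).baseChange ℝ y = 0 := by
      rw [hy, map_sub, map_sub, map_smul, map_smul, baseChange_fst_prodMap, hab]
      module
    by_cases h2 : (LinearMap.snd ℤ L₁ L₂).baseChange ℝ y = 0
    · exact Or.inl (eq_zero_of_baseChange_fst_snd hy₁ h2)
    · right
      rw [orthogonalSum_baseChange_apply, hy₁]
      simpa using baseChange_real_pos hS₂ h2
  exists_neg := by
    have : Nontrivial L₁ := Module.nontrivial_of_finrank_pos (R := ℤ) (by omega)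
    obtain ⟨x, hx⟩ := exists_ne (0 : L₁)
    refine ⟨1 ⊗ₜ (x, 0), ?_⟩
    rw [orthogonalSum_baseChange_apply]
    simpa using hS₁.2 x hx

end OrthogonalSum

/-! ### Rational coefficients and conclusion -/

/-- A rational endomorphism that is a complex scalar over the reals is one over the rationals. -/
theorem exists_rat_eq_add_smul {L : Type*} [AddCommGroup L] [Module.Free ℤ L]
    {S : LinearMap.BilinForm ℤ L} {K : Module.End ℤ L}
    (h : IsLorentzian (S.baseChange ℝ) (K.baseChange ℝ)) {z : L} (hz : S z z ≠ 0)
    {u : Module.End ℚ (ℚ ⊗[ℤ] L)} {a b : ℝ} (hu : ratEndToReal u = a • 1 + b • K.baseChange ℝ) :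
    ∃ a b : ℚ, u = a • (1 : Module.End ℚ (ℚ ⊗[ℤ] L)) + b • K.baseChange ℚ := by
  have hS : S.baseChange ℝ (1 ⊗ₜ z) (1 ⊗ₜ z) = (S z z : ℝ) := by simp
  have hz' : (S z z : ℝ) ≠ 0 := by exact_mod_cast hz
  have huz : ratToReal L (u (1 ⊗ₜ z)) = a • (1 ⊗ₜ z) + b • K.baseChange ℝ (1 ⊗ₜ z) := by
    rw [← ratEndToReal_one_tmul, hu]
    simp
  -- As `z` and `K z` are orthogonal of equal norm, pairing `u z` with them gives `a * S z z` and `b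
  -- * S z z`, both rational.
  obtain ⟨p, hp⟩ := exists_rat_apply_ratToReal S (u (1 ⊗ₜ z)) z
  obtain ⟨q, hq⟩ := exists_rat_apply_ratToReal S (u (1 ⊗ₜ z)) (K z)
  rw [show (1 : ℝ) ⊗ₜ[ℤ] K z = K.baseChange ℝ (1 ⊗ₜ z) by simp] at hq
  rw [huz] at hp hq
  simp only [map_add, map_smul, LinearMap.add_apply, LinearMap.smul_apply, smul_eq_mul,
    h.apply_self, h.apply_self', h.isometry, hS, mul_zero, add_zero, zero_add] at hp hq
  refine ⟨p / S z z, q / S z z, ratEndToReal_injective ?_⟩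
  rw [ratEndToReal_add_smul, hu]
  push_cast
  rw [← hp, ← hq, mul_div_cancel_right₀ _ hz', mul_div_cancel_right₀ _ hz']

theorem mainTheorem6 (g : ℕ) (hg : 3 ≤ g)
    {Λ₁ Λ₂ : Type*} [AddCommGroup Λ₁] [AddCommGroup Λ₂]
    [Module.Free ℤ Λ₁] [Module.Finite ℤ Λ₁] [Module.Free ℤ Λ₂] [Module.Finite ℤ Λ₂]
    (hΛ₁ : Module.finrank ℤ Λ₁ = 2) (hΛ₂ : Module.finrank ℤ Λ₂ = 2 * g - 2)
    (S₁ : LinearMap.BilinForm ℤ Λ₁) (S₂ : LinearMap.BilinForm ℤ Λ₂)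
    (hS₁ : IsSymmPosDef S₁) (hS₂ : IsSymmPosDef S₂)
    (J₁ : Module.End ℤ Λ₁) (J₂ : Module.End ℤ Λ₂)
    (hJ₁ : J₁.baseChange ℝ ∈ specialOrthogonalSet (S₁.baseChange ℝ))
    (hJ₂ : J₂.baseChange ℝ ∈ specialOrthogonalSet (S₂.baseChange ℝ))
    (hJ₁sq : J₁ * J₁ = -1) (hJ₂sq : J₂ * J₂ = -1)
    (S : LinearMap.BilinForm ℤ (Λ₁ × Λ₂)) (hS : S = orthogonalSum (-S₁) S₂)
    (J₀ : Module.End ℤ (Λ₁ × Λ₂)) (hJ₀ : J₀ = J₁.prodMap J₂) :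
    ∃ J : Module.End ℝ (ℝ ⊗[ℤ] (Λ₁ × Λ₂)),
      J ∈ specialOrthogonalSet (S.baseChange ℝ) ∧
      J * J = -1 ∧
      rationalCentraliser J =
        {u | ∃ a b : ℚ, u = a • (1 : Module.End ℚ (ℚ ⊗[ℤ] (Λ₁ × Λ₂))) +
          b • J₀.baseChange ℚ} ∧
      IsSymmPosDef ((S.baseChange ℝ).compl₁₂ J (J₀.baseChange ℝ)) := by
  subst hS hJ₀
  have h := isLorentzian_orthogonalSum hΛ₁ hS₁ hS₂ hJ₁.1 hJ₂.1 hJ₁sq hJ₂sq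
  have hd : 5 ≤ Module.finrank ℝ (ℝ ⊗[ℤ] (Λ₁ × Λ₂)) := by
    rw [Module.finrank_baseChange, Module.finrank_prod]
    omega
  have := countable_end_rat (ℚ ⊗[ℤ] (Λ₁ × Λ₂))
  obtain ⟨v, hv, hvu⟩ := h.exists_neg_forall_commute hd
    (ratEndToReal : Module.End ℚ (ℚ ⊗[ℤ] (Λ₁ × Λ₂)) → _)
  have hsq := h.lineComplexStructure_mul_self hv.ne
  refine ⟨lineComplexStructure _ _ v,
    ⟨h.lineComplexStructure_isometry hv.ne, det_eq_one_of_mul_self_eq_neg_one hsq⟩, hsq, ?_,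
    h.isSymmPosDef hv⟩
  ext u
  constructor
  · intro hu
    obtain ⟨a, b, hab⟩ := hvu u hu
    have : Nontrivial Λ₁ := Module.nontrivial_of_finrank_pos (R := ℤ) (by omega)
    obtain ⟨x, hx⟩ := exists_ne (0 : Λ₁)
    refine exists_rat_eq_add_smul h (z := (x, 0)) ?_ hab
    simpa [orthogonalSum] using (hS₁.2 x hx).ne'
  · rintro ⟨a, b, rfl⟩
    change _ * _ = _ * _
    rw [ratEndToReal_add_smul, add_mul, mul_add, smul_mul_assoc, smul_mul_assoc, mul_smul_comm,
      mul_smul_comm, one_mul, mul_one, h.commute_lineComplexStructure]
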